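/- Let $\mathbb F$ be an algebraically closed field, $\overline{\mathbb F}=\mathbb F\cup\{\infty\}$, and let $A(s)=A_0+sA_1$ with $A_0,A_1\in\mathbb F^{p\times q}$ be a matrix pencil of normal rank $\rho$ (its rank over the field of fractions of $\mathbb F[s]$). Put $A(\infty)=A_1$. For $\lambda\in\overline{\mathbb F}$, a Jordan chain of $A(s)$ at $\lambda$ of length $k+1$ is a tuple $(x_k,\dots,x_0)$ of vectors of $\mathbb F^q$ with $x_0\neq 0$, $A(\lambda)x_0=0$ and, for $1\le i\le k$, $A(\lambda)x_i=-A_1x_{i-1}$ if $\lambda\in\mathbb F$, and $A_1x_i=-A_0x_{i-1}$ if $\lambda=\infty$. Let $\mathcal L^{\ell}_\lambda(A(s))$ be the span of the vectors of all Jordan chains of $A(s)$ at $\lambda$ of length at most $\ell$ (so $\mathcal L^0_\lambda(A(s))=\{0\}$), and let $$w_i(\lambda,A(s))=\dim\bigl(\mathcal L^i_\lambda(A(s))/\mathcal L^{i-1}_\lambda(A(s))\bigr),\qquad i\ge 1.$$ The sequence $w(\lambda,A(s))=(w_1(\lambda,A(s)),w_2(\lambda,A(s)),\dots)$ is the generalized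 Weyr characteristic of $A(s)$ at $\lambda$. Let $\phi_1\mid\cdots\mid\phi_\rho$ in $\mathbb F[s,t]$ be the homogeneous invariant factors of $A(s)$, that is, for each $k\le\rho$ the product $\phi_1\cdots\phi_k$ is the greatest common divisor of the $k\times k$ minors of $tA_0+sA_1$. The partial multiplicities $n_1(\lambda)\ge\dots\ge n_\rho(\lambda)$ of $\lambda$ in $A(s)$ are defined by letting $n_i(\lambda)$ be the exponent of the factor $s-\lambda t$ (of the factor $t$ if $\lambda=\infty$) in $\phi_{\rho-i+1}$. Let $c_1\ge\dots\ge c_{q-\rho}\ge 0$ be the column minimal indices of $A(s)$, that is, the degrees of the vectors of a minimal polynomial basis (one with the least sum of degrees) of the null space of $A(s)$ over $\mathbb F(s)$. For a finite chain $(a_1,\dots,a_m)$ of nonnegative integers, its conjugate partition is $(\bar a_1,\bar a_2,\dots)$, where $\bar a_k=\#\{i: a_i\ge k\}$. Let $(w^R_1(\lambda),w^R_2(\lambda),\dots)=\overline{(n_1(\lambda),\dots,n_\rho(\lambda))}$, let $(r_1,r_2,\dots)=\overline{(c_1,\dots,c_{q-\rho})}$, and let $r_0=q-\rho$. Then, for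 every $\lambda\in\overline{\mathbb F}$, $$w(\lambda,A(s))=(w^R_1(\lambda),w^R_2(\lambda),\dots)+(r_0,r_1,r_2,\dots),$$ that is, $w_i(\lambda,A(s))=w^R_i(\lambda)+r_{i-1}$ for all $i\ge 1$. -/

import Mathlib

open Polynomial

/-- A `p × q` matrix pencil `A(s) = A₀ + s A₁` over `F`. -/
structure MatrixPencil (F : Type*) (p q : ℕ) where
  /-- the constant coefficient `A₀` -/
  A₀ : Matrix (Fin p) (Fin q) F
  /-- the coefficient `A₁` of `s` -/
  A₁ : Matrix (Fin p) (Fin q) F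

namespace MatrixPencil

variable {F : Type*} [Field F] {p q : ℕ}

/-- The pencil as a polynomial matrix `A₀ + s A₁` with entries in `F[s]`. -/
noncomputable def toPoly (A : MatrixPencil F p q) : Matrix (Fin p) (Fin q) F[X] :=
  A.A₀.map Polynomial.C + (X : F[X]) • A.A₁.map Polynomial.C

/-- The normal rank: the rank of `A(s)` over the field of fractions of `F[s]`. -/
noncomputable def normalRank (A : MatrixPencil F p q) : ℕ :=
  (A.toPoly.map (algebraMap F[X] (RatFunc F))).rank

/-! ### Jordan chains and the generalized Weyr characteristic -/

/-- `A(lam) = A₀ + lam A₁` for `lam` in `F`, and `A(∞) = A₁`. -/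
def evalAt (A : MatrixPencil F p q) (lam : OnePoint F) : Matrix (Fin p) (Fin q) F :=
  lam.elim A.A₁ fun a : F => A.A₀ + a • A.A₁

/-- The matrix acting on the preceding vector of a Jordan chain at `lam`:
`A₁` for `lam` in `F`, and `A₀` for `lam = ∞`. -/
def shiftAt (A : MatrixPencil F p q) (lam : OnePoint F) : Matrix (Fin p) (Fin q) F :=
  lam.elim A.A₀ fun _ : F => A.A₁

/-- `(x k, …, x 0)` is a (right) Jordan chain of `A(s)` at `lam`, of length `k + 1`. -/
def IsJordanChain (A : MatrixPencil F p q) (lam : OnePoint F) (k : ℕ)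
    (x : Fin (k + 1) → Fin q → F) : Prop :=
  x 0 ≠ 0 ∧ (A.evalAt lam).mulVec (x 0) = 0 ∧
    ∀ i : Fin k, (A.evalAt lam).mulVec (x i.succ) = -(A.shiftAt lam).mulVec (x i.castSucc)

/-- The span of the vectors of all Jordan chains of `A(s)` at `lam` of length at most `l`. -/
def chainSpace (A : MatrixPencil F p q) (lam : OnePoint F) (l : ℕ) :
    Submodule F (Fin q → F) :=
  Submodule.span F
    {v | ∃ (k : ℕ) (x : Fin (k + 1) → Fin q → F),
      k + 1 ≤ l ∧ A.IsJordanChain lam k x ∧ ∃ j, x j = v}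

/-- The `i`-th component (`i ≥ 1`) of the generalized Weyr characteristic of `A(s)` at `lam`:
the dimension of the quotient of the `i`-th chain space by the `(i - 1)`-st one. -/
noncomputable def weyr (A : MatrixPencil F p q) (lam : OnePoint F) (i : ℕ) : ℕ :=
  Module.finrank F
    (A.chainSpace lam i ⧸ (A.chainSpace lam (i - 1)).submoduleOf (A.chainSpace lam i))

/-! ### Homogeneous invariant factors and partial multiplicities -/

/-- The homogeneous pencil `t A₀ + s A₁` over `F[s, t]`, with `s = X 0` and `t = X 1`. -/
noncomputable def homogenization (A : MatrixPencil F p q) :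
    Matrix (Fin p) (Fin q) (MvPolynomial (Fin 2) F) :=
  (MvPolynomial.X 1 : MvPolynomial (Fin 2) F) • A.A₀.map MvPolynomial.C +
    (MvPolynomial.X 0 : MvPolynomial (Fin 2) F) • A.A₁.map MvPolynomial.C

/-- `D` is a greatest common divisor of the minors of order `k` of `t A₀ + s A₁`. Rows and
columns are picked by arbitrary maps: a repetition gives the minor `0` and a reordering changes
only the sign, so the common divisors are those of the usual minors. -/
def IsDeterminantalDivisor (A : MatrixPencil F p q) (k : ℕ)
    (D : MvPolynomial (Fin 2) F) : Prop :=
  (∀ (f : Fin k → Fin p) (g : Fin k → Fin q), D ∣ (A.homogenization.submatrix f g).det) ∧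
    ∀ E : MvPolynomial (Fin 2) F,
      (∀ (f : Fin k → Fin p) (g : Fin k → Fin q), E ∣ (A.homogenization.submatrix f g).det) →
        E ∣ D

/-- `φ 0, …, φ (ρ - 1)`, `ρ` the normal rank, are the homogeneous invariant factors
`φ₁ ∣ ⋯ ∣ φ_ρ` of `A(s)` (determined up to nonzero constants): for `k ≤ ρ`, the product
`φ₁ ⋯ φ_k` is the greatest common divisor of the minors of order `k` of `t A₀ + s A₁`. -/
def IsHomogeneousInvariantFactors (A : MatrixPencil F p q)
    (φ : Fin A.normalRank → MvPolynomial (Fin 2) F) : Prop :=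
  ∀ k ≤ A.normalRank,
    A.IsDeterminantalDivisor k (∏ j ∈ Finset.univ.filter (fun j : Fin A.normalRank => (j : ℕ) < k), φ j)

/-- The prime form attached to a point: `s - lam t` for `lam` in `F`, and `t` for `∞`. -/
noncomputable def linearForm (lam : OnePoint F) : MvPolynomial (Fin 2) F :=
  lam.elim (MvPolynomial.X 1)
    fun a : F => MvPolynomial.X 0 - MvPolynomial.C a * MvPolynomial.X 1

/-- The partial multiplicities `n₁, …, n_ρ` of `lam`, given the homogeneous invariant factors
`φ₁ ∣ ⋯ ∣ φ_ρ`: `n_i` is the exponent of the form of `lam` in `φ_{ρ - i + 1}`. -/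
noncomputable def partialMultiplicities {r : ℕ} (φ : Fin r → MvPolynomial (Fin 2) F)
    (lam : OnePoint F) (i : Fin r) : ℕ :=
  multiplicity (linearForm lam) (φ i.rev)

/-! ### Column minimal indices -/

/-- The degree of a polynomial vector: the largest degree of its entries. -/
def vecDegree (v : Fin q → F[X]) : ℕ :=
  Finset.univ.sup fun j => (v j).natDegree

/-- `b` is a polynomial basis of the null space of `A(s)` over the field of fractions of `F[s]`:
the polynomial vectors `b j` are annihilated by `A(s)`, they are linearly independent, and their
number is the dimension `q - ρ` of that null space. -/
def IsPolynomialNullBasis (A : MatrixPencil F p q)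
    (b : Fin (q - A.normalRank) → Fin q → F[X]) : Prop :=
  (∀ j, A.toPoly.mulVec (b j) = 0) ∧ LinearIndependent F[X] b

/-- A minimal basis of the null space of `A(s)`: a polynomial basis for which the sum of the
degrees is least possible. -/
def IsMinimalBasis (A : MatrixPencil F p q)
    (b : Fin (q - A.normalRank) → Fin q → F[X]) : Prop :=
  A.IsPolynomialNullBasis b ∧
    ∀ b' : Fin (q - A.normalRank) → Fin q → F[X], A.IsPolynomialNullBasis b' →
      ∑ j, vecDegree (b j) ≤ ∑ j, vecDegree (b' j)

/-- `c₁ ≥ ⋯ ≥ c_{q - ρ}` are the column minimal indices of `A(s)`: the degrees of the vectors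
of a minimal basis of its null space. -/
def IsColumnMinimalIndices (A : MatrixPencil F p q)
    (c : Fin (q - A.normalRank) → ℕ) : Prop :=
  Antitone c ∧
    ∃ b : Fin (q - A.normalRank) → Fin q → F[X],
      A.IsMinimalBasis b ∧ ∀ j, vecDegree (b j) = c j

/-! ### Homogeneous invariant factors and column minimal indices exist -/

theorem exists_isDeterminantalDivisor (A : MatrixPencil F p q) (k : ℕ) :
    ∃ D, A.IsDeterminantalDivisor k D := by
  classical
  let _ := UniqueFactorizationMonoid.toGCDMonoid (MvPolynomial (Fin 2) F)
  let m : (Fin k → Fin p) × (Fin k → Fin q) → MvPolynomial (Fin 2) F :=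
    fun x => (A.homogenization.submatrix x.1 x.2).det
  have key : ∀ s : Finset ((Fin k → Fin p) × (Fin k → Fin q)),
      ∃ D, (∀ x ∈ s, D ∣ m x) ∧ ∀ E, (∀ x ∈ s, E ∣ m x) → E ∣ D := by
    intro s
    induction s using Finset.induction_on with
    | empty => exact ⟨0, by simp, by simp⟩
    | insert a s ha ih =>
      obtain ⟨D, h1, h2⟩ := ih
      refine ⟨gcd (m a) D, ?_, ?_⟩
      · intro x hx
        rcases Finset.mem_insert.1 hx with rfl | hx
        · exact gcd_dvd_left _ _
        · exact (gcd_dvd_right _ _).trans (h1 x hx)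
      · intro E hE
        exact dvd_gcd (hE a (Finset.mem_insert_self _ _))
          (h2 E fun x hx => hE x (Finset.mem_insert_of_mem hx))
  obtain ⟨D, h1, h2⟩ := key Finset.univ
  exact ⟨D, fun f g => h1 (f, g) (Finset.mem_univ _),
    fun E hE => h2 E fun x _ => hE x.1 x.2⟩

theorem IsDeterminantalDivisor.dvd_succ {A : MatrixPencil F p q} {k : ℕ}
    {D E : MvPolynomial (Fin 2) F} (hD : A.IsDeterminantalDivisor k D)
    (hE : A.IsDeterminantalDivisor (k + 1) E) : D ∣ E := by
  refine hE.2 D fun f g => ?_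
  rw [Matrix.det_succ_row_zero]
  refine Finset.dvd_sum fun j _ => Dvd.dvd.mul_left ?_ _
  rw [Matrix.submatrix_submatrix]
  exact hD.1 _ _

/-- Every pencil has homogeneous invariant factors. -/
theorem exists_isHomogeneousInvariantFactors (A : MatrixPencil F p q) :
    ∃ φ, A.IsHomogeneousInvariantFactors φ := by
  classical
  have hex : ∀ k, ∃ D, A.IsDeterminantalDivisor k D ∧ (k = 0 → D = 1) := by
    intro k
    rcases k with _ | k
    · exact ⟨1, ⟨fun f g => one_dvd _, fun E hE => by
        simpa using hE Fin.elim0 Fin.elim0⟩, fun _ => rfl⟩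
    · obtain ⟨D, hD⟩ := A.exists_isDeterminantalDivisor (k + 1)
      exact ⟨D, hD, by simp⟩
  choose D hD hD0 using hex
  choose ψ hψ using fun k => (hD k).dvd_succ (hD (k + 1))
  refine ⟨fun j => ψ j, fun k hk => ?_⟩
  have h : ∀ k ≤ A.normalRank,
      ∏ j ∈ Finset.univ.filter (fun j : Fin A.normalRank => (j : ℕ) < k), ψ j = D k := by
    intro k hk
    induction k with
    | zero => simp [hD0 0 rfl]
    | succ k ih =>
      rw [hψ k, ← ih (by omega)]
      have : Finset.univ.filter (fun j : Fin A.normalRank => (j : ℕ) < k + 1) =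
          insert ⟨k, hk⟩ (Finset.univ.filter (fun j : Fin A.normalRank => (j : ℕ) < k)) := by
        ext j
        simp [Fin.ext_iff]
        omega
      rw [this, Finset.prod_insert (by simp), mul_comm]
  rw [h k hk]
  exact hD k

theorem exists_isPolynomialNullBasis (A : MatrixPencil F p q) :
    ∃ b, A.IsPolynomialNullBasis b := by
  classical
  let M := A.toPoly.map (algebraMap F[X] (RatFunc F))
  have hdim : Module.finrank (RatFunc F) (LinearMap.ker M.mulVecLin) = q - A.normalRank := by
    have := LinearMap.finrank_range_add_finrank_ker M.mulVecLin
    rw [Module.finrank_fin_fun] at this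
    have h2 : A.normalRank = Module.finrank (RatFunc F) (LinearMap.range M.mulVecLin) := rfl
    omega
  let v := Module.finBasisOfFinrankEq (RatFunc F) (LinearMap.ker M.mulVecLin) hdim
  obtain ⟨d, hd⟩ := IsLocalization.exist_integer_multiples_of_finite (nonZeroDivisors F[X])
    (fun x : Fin (q - A.normalRank) × Fin q => (v x.1 : Fin q → RatFunc F) x.2)
  choose b hb using hd
  let B : Fin (q - A.normalRank) → Fin q → F[X] := fun j l => b (j, l)
  have hB : ∀ j, (fun l => algebraMap F[X] (RatFunc F) (B j l)) =
      (algebraMap F[X] (RatFunc F) d) • (v j : Fin q → RatFunc F) := by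
    intro j
    funext l
    have := hb (j, l)
    simpa [Algebra.smul_def] using this
  have hd0 : algebraMap F[X] (RatFunc F) d ≠ 0 := by
    simp
  refine ⟨B, fun j => ?_, ?_⟩
  · funext r
    apply IsFractionRing.injective F[X] (RatFunc F)
    have h1 : M.mulVec (v j : Fin q → RatFunc F) = 0 := (v j).2
    have h2 : M.mulVec (fun l => algebraMap F[X] (RatFunc F) (B j l)) = 0 := by
      rw [hB, Matrix.mulVec_smul, h1, smul_zero]
    have h3 := congrFun h2 r
    simpa [Matrix.mulVec, dotProduct, M] using h3
  · have hli : LinearIndependent (RatFunc F) (fun j => (v j : Fin q → RatFunc F)) :=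
      v.linearIndependent.map' (Submodule.subtype _) (Submodule.ker_subtype _)
    rw [Fintype.linearIndependent_iff] at hli ⊢
    intro g hg j
    have h0 := hli (fun j => algebraMap F[X] (RatFunc F) (g j)) ?_ j
    · exact IsFractionRing.injective F[X] (RatFunc F) (by simpa using h0)
    · have h4 : algebraMap F[X] (RatFunc F) d •
          ∑ j, algebraMap F[X] (RatFunc F) (g j) • (v j : Fin q → RatFunc F) = 0 := by
        rw [Finset.smul_sum]
        simp_rw [smul_comm (algebraMap F[X] (RatFunc F) (d : F[X])), ← hB]
        funext l
        have := congrArg (algebraMap F[X] (RatFunc F)) (congrFun hg l)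
        simpa [Algebra.smul_def] using this
      exact (smul_eq_zero.1 h4).resolve_left hd0

/-- Every pencil has column minimal indices. -/
theorem exists_isColumnMinimalIndices (A : MatrixPencil F p q) :
    ∃ c, A.IsColumnMinimalIndices c := by
  classical
  have hne : ∃ n, ∃ b, A.IsPolynomialNullBasis b ∧ ∑ j, vecDegree (b j) = n := by
    obtain ⟨b, hb⟩ := A.exists_isPolynomialNullBasis
    exact ⟨_, b, hb, rfl⟩
  obtain ⟨b, hb, hn⟩ := Nat.find_spec hne
  let σ := Tuple.sort (fun j => vecDegree (b j))
  let τ : Equiv.Perm (Fin (q - A.normalRank)) := Fin.revPerm.trans σ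
  refine ⟨fun j => vecDegree (b (τ j)), ?_, fun j => b (τ j), ⟨⟨fun j => hb.1 _, ?_⟩, ?_⟩,
    fun j => rfl⟩
  · intro i j hij
    exact Tuple.monotone_sort (fun j => vecDegree (b j)) (Fin.rev_le_rev.2 hij)
  · exact hb.2.comp τ τ.injective
  · intro b' hb'
    rw [Equiv.sum_comp τ (fun j => vecDegree (b j)), hn]
    exact Nat.find_min' hne ⟨b', hb', rfl⟩

end MatrixPencil

/-- The conjugate of a chain of nonnegative integers: its `k`-th term is `#{i : a i ≥ k}`. -/
def conjugateChain {m : ℕ} (a : Fin m → ℕ) (k : ℕ) : ℕ :=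
  (Finset.univ.filter fun i => k ≤ a i).card

/-! Write `B = A.localize lam`, the pencil in a coordinate `s` vanishing at `lam`. A Jordan chain,
read as the coefficients of a polynomial vector `v`, says that `B(s) v` vanishes modulo a power of
`s`. Hence the chain space of level `l` is the image, under the coefficient of `s ^ (l - 1)`, of the
space `T_l` of vectors of degree `< l` with `B v ≡ 0 mod s ^ l` (`chainSpace_eq_map`). The kernel of
this map is the space `N_(l-1)` of true null vectors of degree `< l - 1`, so `dim L^l = dim T_l -
dim N_(l-1)`.

A Smith form of `B` with exponents `e_i` at `s` gives `dim T_l = q l - ∑ (l - e_i)^+`, and comparing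
minors identifies the `e_i` with the partial multiplicities. A minimal basis generates all
polynomial null vectors and has the predictable degree property, so `dim N_l = ∑ (l - c_j)^+`; this
dimension does not change under localization.

Taking the difference of `dim L^i` and `dim L^(i-1)` turns each sum of positive parts into a count,
and these counts are the terms of the two conjugate partitions. -/

namespace MatrixPencil

variable {F : Type*} [Field F] {p q : ℕ}

/-! ### Polynomial vectors of bounded degree -/

/-- The coefficient vector of `s ^ k` in a polynomial vector. -/
noncomputable def coeffVec (k : ℕ) : (Fin q → F[X]) →ₗ[F] (Fin q → F) :=
  LinearMap.pi fun j => (lcoeff F k).comp (LinearMap.proj j)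

@[simp]
theorem coeffVec_apply (k : ℕ) (v : Fin q → F[X]) (j : Fin q) :
    coeffVec k v j = (v j).coeff k := rfl

theorem coeffVec_ext {v w : Fin q → F[X]} (h : ∀ k, coeffVec k v = coeffVec k w) : v = w := by
  funext j
  ext k
  exact congrFun (h k) j

/-- The polynomial vectors of degree less than `n`. -/
noncomputable def polyVec (F : Type*) [Field F] (q n : ℕ) : Submodule F (Fin q → F[X]) :=
  Submodule.pi Set.univ fun _ => degreeLT F n

theorem mem_polyVec {n : ℕ} {v : Fin q → F[X]} : v ∈ polyVec F q n ↔ ∀ j, v j ∈ degreeLT F n := by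
  simp [polyVec, Submodule.mem_pi]

theorem mem_degreeLT_iff_coeff {n : ℕ} {f : F[X]} :
    f ∈ degreeLT F n ↔ ∀ m, n ≤ m → f.coeff m = 0 := by
  rw [mem_degreeLT, degree_lt_iff_coeff_zero]

theorem mem_polyVec_iff_coeffVec {n : ℕ} {v : Fin q → F[X]} :
    v ∈ polyVec F q n ↔ ∀ m, n ≤ m → coeffVec m v = 0 := by
  simp only [mem_polyVec, mem_degreeLT_iff_coeff, funext_iff, coeffVec_apply, Pi.zero_apply]
  exact ⟨fun h m hm j => h j m hm, fun h j m hm => h m hm j⟩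

theorem finrank_degreeLT (n : ℕ) : Module.finrank F (degreeLT F n) = n := by
  rw [(degreeLTEquiv F n).finrank_eq, Module.finrank_fin_fun]

instance (n : ℕ) : Module.Finite F (degreeLT F n) :=
  Module.Finite.equiv (degreeLTEquiv F n).symm

/-- A vector of polynomials of degree less than `n` as an element of `polyVec F q n`. -/
noncomputable def polyVecEquiv (q n : ℕ) : polyVec F q n ≃ₗ[F] (Fin q → degreeLT F n) where
  toFun v j := ⟨v.1 j, mem_polyVec.1 v.2 j⟩
  invFun w := ⟨fun j => w j, mem_polyVec.2 fun j => (w j).2⟩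
  map_add' _ _ := rfl
  map_smul' _ _ := rfl
  left_inv _ := rfl
  right_inv _ := rfl

instance (q n : ℕ) : Module.Finite F (polyVec F q n) :=
  Module.Finite.equiv (polyVecEquiv q n).symm

theorem finrank_polyVec (q n : ℕ) : Module.finrank F (polyVec F q n) = q * n := by
  rw [(polyVecEquiv q n).finrank_eq, Module.finrank_pi_fintype]
  simp [finrank_degreeLT]

theorem natDegree_le_vecDegree (v : Fin q → F[X]) (j : Fin q) :
    (v j).natDegree ≤ vecDegree v :=
  Finset.le_sup (f := fun j => (v j).natDegree) (Finset.mem_univ j)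

theorem vecDegree_lt_of_mem_polyVec {v : Fin q → F[X]} {n : ℕ} (hn : 0 < n)
    (hv : v ∈ polyVec F q n) : vecDegree v < n := by
  rw [vecDegree, Finset.sup_lt_iff hn]
  intro j _
  have := mem_degreeLT.1 (mem_polyVec.1 hv j)
  by_cases h0 : v j = 0
  · simpa [h0] using hn
  · rwa [natDegree_lt_iff_degree_lt h0]

/-- The polynomial null vectors of degree less than `n`. -/
noncomputable def nullVec (A : MatrixPencil F p q) (n : ℕ) : Submodule F (Fin q → F[X]) :=
  polyVec F q n ⊓ (LinearMap.ker A.toPoly.mulVecLin).restrictScalars F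

theorem mem_nullVec {A : MatrixPencil F p q} {n : ℕ} {v : Fin q → F[X]} :
    v ∈ A.nullVec n ↔ v ∈ polyVec F q n ∧ A.toPoly.mulVec v = 0 := by
  simp [nullVec]

instance (A : MatrixPencil F p q) (n : ℕ) : Module.Finite F (A.nullVec n) :=
  Submodule.finiteDimensional_of_le (S₂ := polyVec F q n) inf_le_left

/-! ### Minimal bases -/

section MinimalBasis

variable {A : MatrixPencil F p q} {b : Fin (q - A.normalRank) → Fin q → F[X]}

/-- Exchange property of minimal bases. -/
theorem IsMinimalBasis.vecDegree_le (hb : A.IsMinimalBasis b) {w : Fin q → F[X]}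
    (hw : A.toPoly.mulVec w = 0) {g : F[X]} {a : Fin (q - A.normalRank) → F[X]}
    (h : g • w = ∑ j, a j • b j) {i : Fin (q - A.normalRank)} (hi : a i ≠ 0) :
    vecDegree (b i) ≤ vecDegree w := by
  have hbasis : A.IsPolynomialNullBasis (Function.update b i w) := by
    refine ⟨fun j => ?_, ?_⟩
    · rcases eq_or_ne j i with rfl | hj
      · simpa using hw
      · simpa [hj] using hb.1.1 j
    · rw [Fintype.linearIndependent_iff]
      intro t ht
      have hli := Fintype.linearIndependent_iff.1 hb.1.2
      have e1 : t i • w + ∑ j, (Function.update t i 0) j • b j = 0 := by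
        rw [← ht, Fintype.sum_eq_add_sum_compl i, Fintype.sum_eq_add_sum_compl i]
        simp only [Function.update_self, zero_smul, zero_add]
        congr 1
        refine Finset.sum_congr rfl fun j hj => ?_
        have : j ≠ i := by simpa using hj
        simp [this]
      -- Multiply `e1` by `g` and substitute `g • w`; since `t` is set to zero at `i`, the
      -- coefficient of `b i` is just `t i * a i`.
      have e2 : ∑ j, (t i * a j + g * (Function.update t i 0) j) • b j = 0 := by
        simp only [add_smul, mul_smul, Finset.sum_add_distrib, ← Finset.smul_sum]
        rw [← h, smul_comm, ← smul_add, e1, smul_zero]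
      have hti : t i = 0 := by
        have := hli _ e2 i
        simpa [hi] using this
      rw [hti, zero_smul, zero_add] at e1
      intro j
      rcases eq_or_ne j i with rfl | hj
      · exact hti
      · simpa [hj] using hli _ e1 j
  have hle := hb.2 _ hbasis
  have e : (fun j => vecDegree (Function.update b i w j)) =
      Function.update (fun j => vecDegree (b j)) i (vecDegree w) :=
    Function.comp_update vecDegree b i w
  rw [e, Finset.sum_update_of_mem (Finset.mem_univ i),
    ← Finset.add_sum_erase Finset.univ (fun j => vecDegree (b j)) (Finset.mem_univ i),
    Finset.sdiff_singleton_eq_erase] at hle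
  omega

theorem IsMinimalBasis.vecDegree_lt (hb : A.IsMinimalBasis b) {w : Fin q → F[X]}
    (hw : A.toPoly.mulVec w = 0) {g : F[X]} {a : Fin (q - A.normalRank) → F[X]}
    (h : g • w = ∑ j, a j • b j) {i : Fin (q - A.normalRank)} (hi : a i ≠ 0) {d : ℕ}
    (hd : w ∈ polyVec F q d) : vecDegree (b i) < d := by
  rcases Nat.eq_zero_or_pos d with rfl | hpos
  · have hw0 : w = 0 := coeffVec_ext fun k => by
      rw [mem_polyVec_iff_coeffVec.1 hd k (Nat.zero_le _), map_zero]
    rw [hw0, smul_zero] at h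
    exact absurd (Fintype.linearIndependent_iff.1 hb.1.2 a h.symm i) hi
  · exact (hb.vecDegree_le hw h hi).trans_lt (vecDegree_lt_of_mem_polyVec hpos hd)

theorem mulVec_sum_smul_eq_zero (hb : ∀ j, A.toPoly.mulVec (b j) = 0)
    (a : Fin (q - A.normalRank) → F[X]) : A.toPoly.mulVec (∑ j, a j • b j) = 0 := by
  rw [Matrix.mulVec_sum]
  simp [Matrix.mulVec_smul, hb]

theorem exists_max_of_exists {m : ℕ} (P : Fin m → Prop) (f : Fin m → ℕ) (h : ∃ j, P j) :
    ∃ i, P i ∧ ∀ j, P j → f j ≤ f i := by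
  classical
  obtain ⟨i, hi, hmax⟩ := Finset.exists_max_image (Finset.univ.filter P) f
    (by obtain ⟨j, hj⟩ := h; exact ⟨j, by simpa using hj⟩)
  exact ⟨i, by simpa using hi, fun j hj => hmax j (by simpa using hj)⟩

/-- The leading coefficient vectors of a minimal basis are linearly independent. -/
theorem IsMinimalBasis.linearIndependent_leading (hb : A.IsMinimalBasis b) :
    LinearIndependent F fun j => coeffVec (vecDegree (b j)) (b j) := by
  rw [Fintype.linearIndependent_iff]
  intro α hα
  by_contra! hne
  obtain ⟨i, hi, hmax⟩ := exists_max_of_exists (fun j => α j ≠ 0) (fun j => vecDegree (b j)) hne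
  set d := vecDegree (b i) with hd
  -- The shifts by powers of `s` align all the leading terms in degree `d`, where `hα` cancels them.
  -- The combination thus has degree `< d` and would be a cheaper replacement for `b i`.
  let a : Fin (q - A.normalRank) → F[X] := fun j => C (α j) * X ^ (d - vecDegree (b j))
  have hcoeff : ∀ m, d ≤ m → coeffVec m (∑ j, a j • b j) = 0 := by
    intro m hm
    rw [map_sum]
    have : ∀ j, coeffVec m (a j • b j) =
        if m = d then α j • coeffVec (vecDegree (b j)) (b j) else 0 := by
      intro j
      by_cases h0 : α j = 0
      · simp [a, h0]
      have hj := hmax j h0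
      funext l
      have h1 : (a j * b j l).coeff m = α j * (b j l).coeff (m - (d - vecDegree (b j))) := by
        simp only [a]
        rw [mul_assoc, coeff_C_mul, coeff_X_pow_mul', if_pos (by omega)]
      simp only [coeffVec_apply, Pi.smul_apply, smul_eq_mul, h1]
      split_ifs with hmd
      · subst hmd
        simp only [Pi.smul_apply, coeffVec_apply, smul_eq_mul]
        congr 2
        omega
      · rw [coeff_eq_zero_of_natDegree_lt]
        · simp
        · have := natDegree_le_vecDegree (b j) l
          omega
    simp only [this]
    split_ifs
    · exact hα
    · simp
  have := hb.vecDegree_lt (w := ∑ j, a j • b j) (g := 1) (a := a) (i := i)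
    (mulVec_sum_smul_eq_zero hb.1.1 a) (one_smul _ _) (by simp [a, hi])
    (mem_polyVec_iff_coeffVec.2 hcoeff)
  omega

/-- The family `b` already has as many members as the null space over `F(s)` has dimensions, so
adjoining `w` creates a relation, and `w` must occur in it because `b` is independent. -/
theorem IsPolynomialNullBasis.exists_smul_eq_sum (hb : A.IsPolynomialNullBasis b)
    {w : Fin q → F[X]} (hw : A.toPoly.mulVec w = 0) :
    ∃ g : F[X], g ≠ 0 ∧ ∃ a : Fin (q - A.normalRank) → F[X], g • w = ∑ j, a j • b j := by
  classical
  by_contra! hcon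
  have hli : LinearIndependent F[X] (fun o : Option (Fin (q - A.normalRank)) =>
      o.elim w b) := by
    rw [Fintype.linearIndependent_iff]
    intro t ht
    rw [Fintype.sum_option] at ht
    simp only [Option.elim_none, Option.elim_some] at ht
    have h0 : t none = 0 := by
      by_contra h0
      refine hcon _ h0 (fun j => - t (some j)) ?_
      simpa [Finset.sum_neg_distrib] using eq_neg_of_add_eq_zero_left ht
    rw [h0, zero_smul, zero_add] at ht
    rintro (_ | j)
    · exact h0
    · exact Fintype.linearIndependent_iff.1 hb.2 _ ht j
  let ι : (Fin q → F[X]) →ₗ[F[X]] (Fin q → RatFunc F) :=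
    LinearMap.pi fun l => (Algebra.linearMap F[X] (RatFunc F)).comp (LinearMap.proj l)
  have hι : LinearMap.ker ι = ⊥ := by
    rw [LinearMap.ker_eq_bot]
    intro u v huv
    funext l
    exact IsFractionRing.injective F[X] (RatFunc F) (congrFun huv l)
  have hli2 := (LinearIndependent.iff_fractionRing F[X] (RatFunc F)).1 (hli.map' ι hι)
  let M := A.toPoly.map (algebraMap F[X] (RatFunc F))
  have hker : ∀ u, A.toPoly.mulVec u = 0 → ι u ∈ LinearMap.ker M.mulVecLin := by
    intro u hu
    rw [LinearMap.mem_ker]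
    funext r
    have := congrArg (algebraMap F[X] (RatFunc F)) (congrFun hu r)
    simpa [Matrix.mulVec, dotProduct, M, ι] using this
  have hmem : ∀ o : Option (Fin (q - A.normalRank)),
      (ι ∘ fun o : Option (Fin (q - A.normalRank)) => o.elim w b) o ∈
        LinearMap.ker M.mulVecLin := by
    rintro (_ | j)
    · exact hker _ hw
    · exact hker _ (hb.1 j)
  have hli3 : LinearIndependent (RatFunc F) (fun o =>
      (⟨_, hmem o⟩ : LinearMap.ker M.mulVecLin)) :=
    LinearIndependent.of_comp (Submodule.subtype _) hli2
  have hcard := hli3.fintype_card_le_finrank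
  have hdim := LinearMap.finrank_range_add_finrank_ker M.mulVecLin
  rw [Module.finrank_fin_fun] at hdim
  have h2 : A.normalRank = Module.finrank (RatFunc F) (LinearMap.range M.mulVecLin) := rfl
  rw [Fintype.card_option, Fintype.card_fin] at hcard
  omega

/-- Dividing each `a j` by `X - x` leaves a null vector `w'` with `(X - x) w'` a constant
combination of the `b j`. If it were nonzero, `w'` would have smaller degree than the largest `b i`
involved, against the exchange property. -/
theorem IsMinimalBasis.exists_eq_sum_of_linear (hb : A.IsMinimalBasis b)
    {w : Fin q → F[X]} (hw : A.toPoly.mulVec w = 0) {x : F}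
    (h : ∃ a : Fin (q - A.normalRank) → F[X], (X - C x) • w = ∑ j, a j • b j) :
    ∃ a : Fin (q - A.normalRank) → F[X], w = ∑ j, a j • b j := by
  obtain ⟨a, ha⟩ := h
  let a' : Fin (q - A.normalRank) → F[X] := fun j => a j /ₘ (X - C x)
  let α : Fin (q - A.normalRank) → F := fun j => (a j).eval x
  have hdiv : ∀ j, a j = (X - C x) * a' j + C (α j) := by
    intro j
    have := modByMonic_add_div (a j) (X - C x)
    rw [modByMonic_X_sub_C_eq_C_eval] at this
    rw [add_comm]
    exact this.symm
  set w' := w - ∑ j, a' j • b j with hw'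
  have hw'0 : A.toPoly.mulVec w' = 0 := by
    rw [hw', Matrix.mulVec_sub, hw, mulVec_sum_smul_eq_zero hb.1.1, sub_zero]
  have hmul : (X - C x) • w' = ∑ j, C (α j) • b j := by
    rw [hw', smul_sub, ha, Finset.smul_sum, ← Finset.sum_sub_distrib]
    refine Finset.sum_congr rfl fun j _ => ?_
    conv_lhs => rw [hdiv j]
    rw [add_smul, mul_smul, add_sub_cancel_left]
  refine ⟨a', sub_eq_zero.1 ?_⟩
  rw [← hw']
  by_contra hne
  have hex : ∃ j, α j ≠ 0 := by
    by_contra! hall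
    simp only [hall, map_zero, zero_smul, Finset.sum_const_zero] at hmul
    exact hne ((smul_eq_zero.1 hmul).resolve_left (X_sub_C_ne_zero x))
  obtain ⟨i, hi, hmax⟩ := exists_max_of_exists (fun j => α j ≠ 0) (fun j => vecDegree (b j)) hex
  refine lt_irrefl _ (hb.vecDegree_lt hw'0 hmul (i := i) (by simpa using hi)
    (d := vecDegree (b i)) (mem_polyVec.2 fun l => ?_))
  by_cases h0 : w' l = 0
  · rw [h0]
    exact Submodule.zero_mem _
  rw [mem_degreeLT, ← natDegree_lt_iff_degree_lt h0]
  have h1 := congrArg natDegree (congrFun hmul l)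
  rw [Pi.smul_apply, smul_eq_mul, natDegree_mul (X_sub_C_ne_zero x) h0, natDegree_X_sub_C] at h1
  have h2 : natDegree ((∑ j, C (α j) • b j) l) ≤ vecDegree (b i) := by
    rw [Finset.sum_apply]
    refine natDegree_sum_le_of_forall_le _ _ fun j _ => ?_
    by_cases hj : α j = 0
    · simp [hj]
    · exact (natDegree_C_mul_le _ _).trans ((natDegree_le_vecDegree _ _).trans (hmax j hj))
  omega

/-- A minimal basis generates the module of polynomial null vectors. -/
theorem IsMinimalBasis.exists_eq_sum [IsAlgClosed F] (hb : A.IsMinimalBasis b)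
    {w : Fin q → F[X]} (hw : A.toPoly.mulVec w = 0) :
    ∃ a : Fin (q - A.normalRank) → F[X], w = ∑ j, a j • b j := by
  obtain ⟨g, hg, h⟩ := hb.1.exists_smul_eq_sum hw
  induction hn : g.natDegree generalizing g w with
  | zero =>
    obtain ⟨a, ha⟩ := h
    rw [eq_C_of_natDegree_eq_zero hn] at ha hg
    have h0 : g.coeff 0 ≠ 0 := fun h => hg (by simp [h])
    refine ⟨fun j => C (g.coeff 0)⁻¹ * a j, ?_⟩
    simp only [mul_smul, ← Finset.smul_sum]
    rw [← ha, smul_smul, ← C_mul, inv_mul_cancel₀ h0, C_1, one_smul]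
  | succ n ih =>
    -- The denominator `g` is removed one linear factor at a time.
    obtain ⟨x, hx⟩ := IsAlgClosed.exists_root g (by
      rw [degree_eq_natDegree hg, hn]
      exact_mod_cast Nat.succ_ne_zero n)
    obtain ⟨k, rfl⟩ := dvd_iff_isRoot.2 hx
    have hk : k ≠ 0 := right_ne_zero_of_mul hg
    rw [natDegree_mul (X_sub_C_ne_zero x) hk, natDegree_X_sub_C] at hn
    refine ih hw k hk ?_ (by omega)
    refine hb.exists_eq_sum_of_linear (x := x) ?_ ?_
    · rw [Matrix.mulVec_smul, hw, smul_zero]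
    · simpa only [smul_smul] using h

/-- Predictable degree property of minimal bases. -/
theorem IsMinimalBasis.mem_degreeLT (hb : A.IsMinimalBasis b)
    {a : Fin (q - A.normalRank) → F[X]} {n : ℕ} (h : ∑ j, a j • b j ∈ polyVec F q n)
    (j : Fin (q - A.normalRank)) : a j ∈ degreeLT F (n - vecDegree (b j)) := by
  by_contra hj
  have hj0 : a j ≠ 0 := by
    intro h0
    rw [h0] at hj
    exact hj (Submodule.zero_mem _)
  rw [Polynomial.mem_degreeLT, ← natDegree_lt_iff_degree_lt hj0] at hj
  obtain ⟨i, hi, hmax⟩ := exists_max_of_exists (fun j => a j ≠ 0)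
    (fun j => (a j).natDegree + vecDegree (b j)) ⟨j, hj0⟩
  set m := (a i).natDegree + vecDegree (b i) with hm
  have h0 := mem_polyVec_iff_coeffVec.1 h m (by have := hmax j hj0; omega)
  rw [map_sum] at h0
  -- Terms not reaching degree `m` fit the same formula: their coefficient of `a j` lies above its
  -- degree and is zero. So `h0` is a relation among the leading vectors, with the leading
  -- coefficient of `a i` in it.
  have h1 : ∀ j, coeffVec m (a j • b j) =
      (a j).coeff (m - vecDegree (b j)) • coeffVec (vecDegree (b j)) (b j) := by
    intro j
    by_cases h0 : a j = 0
    · simp [h0]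
    have hj := hmax j h0
    funext l
    have e : m = (m - vecDegree (b j)) + vecDegree (b j) := by omega
    simp only [coeffVec_apply, Pi.smul_apply, smul_eq_mul]
    conv_lhs => rw [e]
    exact coeff_mul_add_eq_of_natDegree_le (by omega) (natDegree_le_vecDegree _ _)
  simp only [h1] at h0
  have := Fintype.linearIndependent_iff.1 hb.linearIndependent_leading _ h0 i
  rw [hm, Nat.add_sub_cancel] at this
  exact hi (leadingCoeff_eq_zero.1 this)

theorem smul_mem_polyVec {v : Fin q → F[X]} {n : ℕ} {f : F[X]}
    (hf : f ∈ degreeLT F (n - vecDegree v)) : f • v ∈ polyVec F q n := by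
  rw [mem_polyVec]
  intro l
  by_cases h0 : f = 0
  · rw [h0, zero_smul]
    exact Submodule.zero_mem _
  rw [Polynomial.mem_degreeLT, ← natDegree_lt_iff_degree_lt h0] at hf
  rw [mem_degreeLT_iff_coeff]
  intro m hm
  refine coeff_eq_zero_of_natDegree_lt (natDegree_mul_le.trans_lt ?_)
  have := natDegree_le_vecDegree v l
  omega

/-- The dimension of the space of polynomial null vectors of bounded degree. -/
theorem IsMinimalBasis.finrank_nullVec [IsAlgClosed F] (hb : A.IsMinimalBasis b) (n : ℕ) :
    Module.finrank F (A.nullVec n) = ∑ j, (n - vecDegree (b j)) := by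
  let Φ : (∀ j, degreeLT F (n - vecDegree (b j))) →ₗ[F] A.nullVec n :=
    { toFun := fun a => ⟨∑ j, (a j : F[X]) • b j, mem_nullVec.2
        ⟨Submodule.sum_mem _ fun j _ => smul_mem_polyVec (a j).2,
          mulVec_sum_smul_eq_zero hb.1.1 _⟩⟩
      map_add' := fun a a' => by
        ext1
        simp [add_smul, Finset.sum_add_distrib]
      map_smul' := fun t a => by
        ext1
        simp [Finset.smul_sum] }
  have hinj : Function.Injective Φ := by
    rw [injective_iff_map_eq_zero]
    intro a ha
    funext j
    exact Subtype.ext (Fintype.linearIndependent_iff.1 hb.1.2 _ (congrArg Subtype.val ha) j)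
  have hsurj : Function.Surjective Φ := by
    rintro ⟨v, hv⟩
    obtain ⟨hv1, hv2⟩ := mem_nullVec.1 hv
    obtain ⟨a, rfl⟩ := hb.exists_eq_sum hv2
    exact ⟨fun j => ⟨a j, hb.mem_degreeLT hv1 j⟩, rfl⟩
  rw [← (LinearEquiv.ofBijective Φ ⟨hinj, hsurj⟩).finrank_eq, Module.finrank_pi_fintype]
  simp [finrank_degreeLT]

theorem IsColumnMinimalIndices.finrank_nullVec [IsAlgClosed F]
    {c : Fin (q - A.normalRank) → ℕ} (hc : A.IsColumnMinimalIndices c) (n : ℕ) :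
    Module.finrank F (A.nullVec n) = ∑ j, (n - c j) := by
  obtain ⟨_, b, hb, h⟩ := hc
  simp [hb.finrank_nullVec, h]

end MinimalBasis

/-! ### The pencil in a local coordinate at a point -/

/-- The pencil `A(s)` rewritten in a local coordinate at `lam`. -/
def localize (A : MatrixPencil F p q) (lam : OnePoint F) : MatrixPencil F p q :=
  ⟨A.evalAt lam, A.shiftAt lam⟩

theorem coeffVec_zero_mulVec (A : MatrixPencil F p q) (v : Fin q → F[X]) :
    coeffVec 0 (A.toPoly.mulVec v) = A.A₀.mulVec (coeffVec 0 v) := by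
  funext r
  simp [toPoly, Matrix.mulVec, dotProduct, add_mul, mul_assoc]

theorem coeffVec_succ_mulVec (A : MatrixPencil F p q) (v : Fin q → F[X]) (k : ℕ) :
    coeffVec (k + 1) (A.toPoly.mulVec v) =
      A.A₀.mulVec (coeffVec (k + 1) v) + A.A₁.mulVec (coeffVec k v) := by
  funext r
  simp [toPoly, Matrix.mulVec, dotProduct, add_mul, mul_assoc,
    coeff_X_mul, Finset.sum_add_distrib]

theorem toPoly_mulVec_eq_zero_iff {A : MatrixPencil F p q} {v : Fin q → F[X]} :
    A.toPoly.mulVec v = 0 ↔ A.A₀.mulVec (coeffVec 0 v) = 0 ∧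
      ∀ k, A.A₀.mulVec (coeffVec (k + 1) v) + A.A₁.mulVec (coeffVec k v) = 0 := by
  constructor
  · intro h
    refine ⟨?_, fun k => ?_⟩
    · rw [← coeffVec_zero_mulVec, h, map_zero]
    · rw [← coeffVec_succ_mulVec, h, map_zero]
  · rintro ⟨h0, h1⟩
    refine coeffVec_ext fun k => ?_
    rw [map_zero]
    rcases k with _ | k
    · rw [coeffVec_zero_mulVec, h0]
    · rw [coeffVec_succ_mulVec, h1]

theorem toPoly_localize_coe (A : MatrixPencil F p q) (x : F) :
    (A.localize (x : OnePoint F)).toPoly = A.toPoly.map (taylorAlgHom x) := by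
  ext1 r c
  simp only [localize, toPoly, evalAt, shiftAt, OnePoint.elim_some, Matrix.map_apply,
    Matrix.add_apply, Matrix.smul_apply, smul_eq_mul, map_add, map_mul, taylorAlgHom_apply,
    taylor_C, taylor_X]
  ring

theorem mulVec_localize_coe (A : MatrixPencil F p q) (x : F) (v : Fin q → F[X]) :
    (A.localize (x : OnePoint F)).toPoly.mulVec (fun j => taylorAlgHom x (v j)) =
      fun r => taylorAlgHom x (A.toPoly.mulVec v r) := by
  rw [toPoly_localize_coe]
  funext r
  simp [Matrix.mulVec, dotProduct]

theorem coeffVec_reflect (n k : ℕ) (v : Fin q → F[X]) :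
    coeffVec k (fun j => reflect n (v j)) = coeffVec (revAt n k) v := by
  funext j
  simp [coeff_reflect]

/-- At a finite point the substitution `s ↦ s + x` preserves degrees; at infinity, reversing the
coefficients of a null vector exchanges the roles of `A₀` and `A₁`. Both maps are injective, and
equality follows because localization can be undone by another localization. -/
theorem finrank_nullVec_le_localize (A : MatrixPencil F p q) (lam : OnePoint F) (n : ℕ) :
    Module.finrank F (A.nullVec n) ≤ Module.finrank F ((A.localize lam).nullVec n) := by
  induction lam using OnePoint.rec with
  | coe x =>
    let Φ : A.nullVec n →ₗ[F] (A.localize (x : OnePoint F)).nullVec n :=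
      { toFun := fun v => ⟨fun j => taylorAlgHom x (v.1 j), by
          obtain ⟨h1, h2⟩ := mem_nullVec.1 v.2
          refine mem_nullVec.2 ⟨mem_polyVec.2 fun j => ?_, ?_⟩
          · have := mem_degreeLT.1 (mem_polyVec.1 h1 j)
            rw [mem_degreeLT]
            simpa using this
          · rw [mulVec_localize_coe, h2]
            funext r
            simp⟩
        map_add' := fun v w => by
          ext1
          funext j
          simp
        map_smul' := fun t v => by
          ext1
          funext j
          simp }
    refine LinearMap.finrank_le_finrank_of_injective (f := Φ) fun v w h => ?_
    ext1
    funext j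
    exact taylor_injective x (congrFun (congrArg Subtype.val h) j)
  | infty =>
    rcases n with _ | n
    · have : A.nullVec 0 = ⊥ := by
        rw [eq_bot_iff]
        intro v hv
        refine (Submodule.mem_bot F).2 (coeffVec_ext fun k => ?_)
        rw [mem_polyVec_iff_coeffVec.1 (mem_nullVec.1 hv).1 k (Nat.zero_le _), map_zero]
      rw [this, finrank_bot]
      exact Nat.zero_le _
    let Φ : A.nullVec (n + 1) →ₗ[F] (A.localize (OnePoint.infty : OnePoint F)).nullVec (n + 1) :=
      { toFun := fun v => ⟨fun j => reflect n (v.1 j), by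
          obtain ⟨h1, h2⟩ := mem_nullVec.1 v.2
          rw [mem_polyVec_iff_coeffVec] at h1
          rw [toPoly_mulVec_eq_zero_iff] at h2
          refine mem_nullVec.2 ⟨mem_polyVec_iff_coeffVec.2 fun m hm => ?_,
            toPoly_mulVec_eq_zero_iff.2 ?_⟩
          · rw [coeffVec_reflect, revAt_eq_self_of_lt (by omega), h1 m hm]
          · simp only [coeffVec_reflect, localize, evalAt, shiftAt, OnePoint.elim_infty]
            refine ⟨?_, fun k => ?_⟩
            -- The lowest equation of the reversed pencil is the highest one of `A`, in degree `n +
            -- 1`, where the coefficient of `v` vanishes.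
            · have := h2.2 n
              rw [h1 (n + 1) le_rfl, Matrix.mulVec_zero, zero_add] at this
              rwa [revAt_le (Nat.zero_le n)]
            · rcases lt_trichotomy k n with hk | rfl | hk
              · rw [revAt_le (by omega), revAt_le (by omega), add_comm]
                have := h2.2 (n - (k + 1))
                rwa [show n - (k + 1) + 1 = n - k by omega] at this
              · rw [revAt_eq_self_of_lt (by omega), revAt_le le_rfl, Nat.sub_self,
                  h1 _ le_rfl, h2.1, Matrix.mulVec_zero, zero_add]
              · rw [revAt_eq_self_of_lt (by omega), revAt_eq_self_of_lt (by omega),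
                  h1 _ (by omega), h1 _ (by omega), Matrix.mulVec_zero, Matrix.mulVec_zero,
                  zero_add]⟩
        map_add' := fun v w => by
          ext1
          funext j
          simp
        map_smul' := fun t v => by
          ext1
          funext j
          simp [smul_eq_C_mul] }
    refine LinearMap.finrank_le_finrank_of_injective (f := Φ) fun v w h => ?_
    ext1
    funext j
    have := congrArg (reflect n) (congrFun (congrArg Subtype.val h) j)
    simpa [Φ] using this

theorem exists_localize_localize (A : MatrixPencil F p q) (lam : OnePoint F) :
    ∃ mu, (A.localize lam).localize mu = A := by
  induction lam using OnePoint.rec with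
  | coe x =>
    refine ⟨((-x : F) : OnePoint F), ?_⟩
    simp [localize, evalAt, shiftAt]
  | infty =>
    refine ⟨OnePoint.infty, ?_⟩
    simp [localize, evalAt, shiftAt]

theorem finrank_nullVec_localize (A : MatrixPencil F p q) (lam : OnePoint F) (n : ℕ) :
    Module.finrank F ((A.localize lam).nullVec n) = Module.finrank F (A.nullVec n) := by
  refine le_antisymm ?_ (A.finrank_nullVec_le_localize lam n)
  obtain ⟨mu, hmu⟩ := A.exists_localize_localize lam
  conv_rhs => rw [← hmu]
  exact finrank_nullVec_le_localize _ mu n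

theorem normalRank_le (A : MatrixPencil F p q) : A.normalRank ≤ q :=
  (Matrix.rank_le_card_width _).trans_eq (Fintype.card_fin q)

/-- Once `n` exceeds every minimal index, each basis vector contributes one new dimension. The
normal rank can thus be read off dimensions known to be invariant under localization. -/
theorem finrank_nullVec_succ [IsAlgClosed F] (A : MatrixPencil F p q) :
    ∃ N, ∀ n, N ≤ n → Module.finrank F (A.nullVec (n + 1)) =
      Module.finrank F (A.nullVec n) + (q - A.normalRank) := by
  obtain ⟨c, hc⟩ := A.exists_isColumnMinimalIndices
  refine ⟨Finset.univ.sup c, fun n hn => ?_⟩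
  rw [hc.finrank_nullVec, hc.finrank_nullVec]
  have : ∀ j, n + 1 - c j = (n - c j) + 1 := by
    intro j
    have := (Finset.le_sup (f := c) (Finset.mem_univ j)).trans hn
    omega
  simp [this, Finset.sum_add_distrib]

theorem normalRank_localize [IsAlgClosed F] (A : MatrixPencil F p q) (lam : OnePoint F) :
    (A.localize lam).normalRank = A.normalRank := by
  obtain ⟨N, hN⟩ := A.finrank_nullVec_succ
  obtain ⟨N', hN'⟩ := (A.localize lam).finrank_nullVec_succ
  have h1 := hN (N + N') (by omega)
  have h2 := hN' (N + N') (by omega)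
  rw [finrank_nullVec_localize, finrank_nullVec_localize] at h2
  have := A.normalRank_le
  have := (A.localize lam).normalRank_le
  omega

/-! ### Chain spaces and null vectors modulo a power of the local coordinate -/

/-- The polynomial vectors of degree less than `n` annihilated by `A(s)` modulo `s ^ n`. -/
noncomputable def truncNullVec (A : MatrixPencil F p q) (n : ℕ) : Submodule F (Fin q → F[X]) where
  carrier := {v | v ∈ polyVec F q n ∧ ∀ m < n, coeffVec m (A.toPoly.mulVec v) = 0}
  add_mem' := by
    rintro v w ⟨h1, h2⟩ ⟨h3, h4⟩
    refine ⟨Submodule.add_mem _ h1 h3, fun m hm => ?_⟩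
    rw [Matrix.mulVec_add, map_add, h2 m hm, h4 m hm, add_zero]
  zero_mem' := ⟨Submodule.zero_mem _, fun m _ => by rw [Matrix.mulVec_zero, map_zero]⟩
  smul_mem' := by
    rintro t v ⟨h1, h2⟩
    refine ⟨Submodule.smul_mem _ _ h1, fun m hm => ?_⟩
    rw [Matrix.mulVec_smul, map_smul, h2 m hm, smul_zero]

theorem mem_truncNullVec {A : MatrixPencil F p q} {n : ℕ} {v : Fin q → F[X]} :
    v ∈ A.truncNullVec n ↔
      v ∈ polyVec F q n ∧ ∀ m < n, coeffVec m (A.toPoly.mulVec v) = 0 := Iff.rfl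

instance (A : MatrixPencil F p q) (n : ℕ) : Module.Finite F (A.truncNullVec n) :=
  Submodule.finiteDimensional_of_le (S₂ := polyVec F q n) fun _ h => h.1

theorem nullVec_le_truncNullVec (A : MatrixPencil F p q) (n : ℕ) :
    A.nullVec (n - 1) ≤ A.truncNullVec n := by
  intro v hv
  obtain ⟨h1, h2⟩ := mem_nullVec.1 hv
  refine ⟨?_, fun m _ => by rw [h2, map_zero]⟩
  rw [mem_polyVec_iff_coeffVec] at h1 ⊢
  exact fun m hm => h1 m (by omega)

/-- If the top coefficient vanishes, `A(s) v` has degree `< n`, so vanishing modulo `s ^ n` means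
vanishing. -/
theorem ker_coeffVec_domRestrict (A : MatrixPencil F p q) (n : ℕ) :
    LinearMap.ker ((coeffVec (n - 1)).domRestrict (A.truncNullVec n)) =
      (A.nullVec (n - 1)).comap (A.truncNullVec n).subtype := by
  ext ⟨v, hv⟩
  simp only [LinearMap.mem_ker, LinearMap.domRestrict_apply, Submodule.mem_comap,
    Submodule.subtype_apply, mem_nullVec]
  obtain ⟨h1, h2⟩ := hv
  rw [mem_polyVec_iff_coeffVec] at h1 ⊢
  constructor
  · intro h0
    have h3 : ∀ m, n - 1 ≤ m → coeffVec m v = 0 := by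
      intro m hm
      rcases hm.eq_or_lt with rfl | hlt
      · exact h0
      · exact h1 m (by omega)
    refine ⟨h3, coeffVec_ext fun m => ?_⟩
    rw [map_zero]
    by_cases hm : m < n
    · exact h2 m hm
    rcases m with _ | m
    · rw [coeffVec_zero_mulVec, h3 0 (by omega), Matrix.mulVec_zero]
    · rw [coeffVec_succ_mulVec, h3 _ (by omega), h3 _ (by omega), Matrix.mulVec_zero,
        Matrix.mulVec_zero, zero_add]
  · exact fun h => h.1 _ le_rfl

theorem finrank_truncNullVec_eq_add (A : MatrixPencil F p q) (n : ℕ) :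
    Module.finrank F (A.truncNullVec n) =
      Module.finrank F ((A.truncNullVec n).map (coeffVec (n - 1))) +
        Module.finrank F (A.nullVec (n - 1)) := by
  rw [← LinearMap.finrank_range_add_finrank_ker
    ((coeffVec (n - 1)).domRestrict (A.truncNullVec n)), ker_coeffVec_domRestrict,
    LinearMap.range_domRestrict,
    (Submodule.comapSubtypeEquivOfLe (A.nullVec_le_truncNullVec n)).finrank_eq]

theorem exists_coeffVec_eq (y : ℕ → Fin q → F) (n : ℕ) (hy : ∀ m, n ≤ m → y m = 0) :
    ∃ v : Fin q → F[X], ∀ m, coeffVec m v = y m := by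
  refine ⟨fun j => ∑ i ∈ Finset.range n, C (y i j) * X ^ i, fun m => ?_⟩
  funext j
  simp only [coeffVec_apply, finsetSum_coeff, coeff_C_mul, coeff_X_pow, mul_ite, mul_one,
    mul_zero, Finset.sum_ite_eq, Finset.mem_range]
  split_ifs with h
  · rfl
  · rw [hy m (by omega), Pi.zero_apply]

theorem mem_map_truncNullVec_of_chain (A : MatrixPencil F p q) {x : ℕ → Fin q → F} {l k : ℕ}
    (hk : k < l) (h0 : A.A₀.mulVec (x 0) = 0)
    (h1 : ∀ i < k, A.A₀.mulVec (x (i + 1)) = -A.A₁.mulVec (x i)) :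
    x k ∈ (A.truncNullVec l).map (coeffVec (l - 1)) := by
  -- The vectors `x 0, …, x k` are placed in degrees `l - 1 - k, …, l - 1`, so that `x k` is the top
  -- coefficient; the later part of the chain is not needed.
  obtain ⟨v, hv⟩ := exists_coeffVec_eq
    (fun m => if l - 1 - k ≤ m ∧ m < l then x (m - (l - 1 - k)) else 0) l
    (fun m hm => if_neg (by omega))
  refine ⟨v, ⟨mem_polyVec_iff_coeffVec.2 fun m hm => ?_, fun m hm => ?_⟩, ?_⟩
  · rw [hv, if_neg (by omega)]
  · rcases m with _ | m
    · rw [coeffVec_zero_mulVec, hv]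
      split_ifs with h
      · rw [Nat.zero_sub, h0]
      · rw [Matrix.mulVec_zero]
    · rw [coeffVec_succ_mulVec, hv, hv]
      rcases lt_trichotomy (m + 1) (l - 1 - k) with h | h | h
      · rw [if_neg (by omega), if_neg (by omega), Matrix.mulVec_zero, Matrix.mulVec_zero, zero_add]
      · rw [if_pos (by omega), if_neg (by omega), h, Nat.sub_self, h0, Matrix.mulVec_zero,
          zero_add]
      · rw [if_pos (by omega), if_pos (by omega),
          show m + 1 - (l - 1 - k) = m - (l - 1 - k) + 1 by omega, h1 _ (by omega),
          neg_add_cancel]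
  · rw [hv, if_pos (by omega)]
    congr 1
    omega

/-- Each vector of a chain ends a shorter chain, hence is a top coefficient. Conversely the
coefficients of a truncated null vector form a chain once the leading zeros are dropped, so the
chain vectors together with `0` already form a subspace. -/
theorem chainSpace_eq_map (A : MatrixPencil F p q) (lam : OnePoint F) (l : ℕ) :
    A.chainSpace lam l = ((A.localize lam).truncNullVec l).map (coeffVec (l - 1)) := by
  apply le_antisymm
  · refine Submodule.span_le.2 ?_
    rintro _ ⟨k, x, hkl, ⟨_, h1, h2⟩, j, rfl⟩
    let x' : ℕ → Fin q → F := fun i => if h : i < k + 1 then x ⟨i, h⟩ else 0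
    have hx' : ∀ j : Fin (k + 1), x' j = x j := fun j => dif_pos j.2
    rw [SetLike.mem_coe, ← hx' j]
    refine mem_map_truncNullVec_of_chain _ (by omega) ?_ fun i hi => ?_
    · exact (congrArg _ (hx' 0)).trans h1
    · have := h2 ⟨i, by omega⟩
      rw [← hx', ← hx'] at this
      exact this
  · rintro _ ⟨v, ⟨h1, h2⟩, rfl⟩
    rw [mem_polyVec_iff_coeffVec] at h1
    by_cases hv : coeffVec (l - 1) v = 0
    · rw [hv]
      exact Submodule.zero_mem _
    classical
    have hex : ∃ m, coeffVec m v ≠ 0 := ⟨_, hv⟩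
    -- The chain starts at the first nonzero coefficient, as its initial vector must not vanish.
    obtain ⟨m, hm, hmin⟩ : ∃ m, coeffVec m v ≠ 0 ∧ ∀ i < m, coeffVec i v = 0 :=
      ⟨Nat.find hex, Nat.find_spec hex, fun i hi => not_not.1 (Nat.find_min hex hi)⟩
    have hml : m < l := by
      by_contra h
      exact hm (h1 m (by omega))
    have hml' : m ≤ l - 1 := by omega
    refine Submodule.subset_span ⟨l - 1 - m, fun i => coeffVec (m + i) v, by omega,
      ⟨hm, ?_, fun i => ?_⟩, Fin.last _, ?_⟩
    · change (A.localize lam).A₀.mulVec (coeffVec m v) = 0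
      rcases m with _ | m
      · rw [← coeffVec_zero_mulVec, h2 0 hml]
      · have := h2 (m + 1) hml
        rwa [coeffVec_succ_mulVec, hmin m (by omega), Matrix.mulVec_zero, add_zero] at this
    · have := h2 (m + i + 1) (by omega)
      rw [coeffVec_succ_mulVec] at this
      exact eq_neg_of_add_eq_zero_left this
    · simp only [Fin.val_last]
      congr 2
      omega

theorem chainSpace_mono (A : MatrixPencil F p q) (lam : OnePoint F) {l l' : ℕ} (h : l ≤ l') :
    A.chainSpace lam l ≤ A.chainSpace lam l' := by
  refine Submodule.span_mono ?_
  rintro v ⟨k, x, hk, hx⟩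
  exact ⟨k, x, hk.trans h, hx⟩

theorem weyr_add_finrank (A : MatrixPencil F p q) (lam : OnePoint F) (i : ℕ) :
    A.weyr lam i + Module.finrank F (A.chainSpace lam (i - 1)) =
      Module.finrank F (A.chainSpace lam i) := by
  rw [weyr, ← (Submodule.submoduleOfEquivOfLe
    (A.chainSpace_mono lam (Nat.sub_le i 1))).finrank_eq]
  exact Submodule.finrank_quotient_add_finrank _

theorem finrank_chainSpace_add (A : MatrixPencil F p q) (lam : OnePoint F) (l : ℕ) :
    Module.finrank F (A.chainSpace lam l) + Module.finrank F (A.nullVec (l - 1)) =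
      Module.finrank F ((A.localize lam).truncNullVec l) := by
  rw [chainSpace_eq_map, finrank_truncNullVec_eq_add, finrank_nullVec_localize]

/-! ### Smith form with respect to the powers of `s` -/

section Smith

/-- Apply the Smith normal form to the column module of `M`. The columns of `U` are the adapted
basis vectors of the ambient module, `V` takes coordinates of `M x` in the basis of the image, and
`W` lifts that basis. One-sided inverses suffice, so the zero block never appears. -/
theorem exists_smith_factorization {R : Type*} [CommRing R] [IsDomain R] [IsPrincipalIdealRing R]
    {p q : ℕ} (M : Matrix (Fin p) (Fin q) R) :
    ∃ (n : ℕ) (U : Matrix (Fin p) (Fin n) R) (L : Matrix (Fin n) (Fin p) R) (a : Fin n → R)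
      (V : Matrix (Fin n) (Fin q) R) (W : Matrix (Fin q) (Fin n) R),
      (∀ i, a i ≠ 0) ∧ L * U = 1 ∧ V * W = 1 ∧ M = U * Matrix.diagonal a * V := by
  classical
  obtain ⟨n, S⟩ := (LinearMap.range M.mulVecLin).smithNormalForm (Pi.basisFun R (Fin p))
  have hw : ∀ i, ∃ w, M.mulVec w = S.bN i := fun i => (S.bN i).2
  choose w hw using hw
  let l : (Fin p → R) →ₗ[R] (Fin n → R) :=
    (LinearMap.funLeft R R S.f).comp S.bM.equivFun.toLinearMap
  let v : (Fin q → R) →ₗ[R] (Fin n → R) :=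
    S.bN.equivFun.toLinearMap.comp M.mulVecLin.rangeRestrict
  refine ⟨n, Matrix.of fun r i => S.bM (S.f i) r, LinearMap.toMatrix' l, S.a,
    LinearMap.toMatrix' v, Matrix.of fun c i => w i c, fun i hi => ?_, ?_, ?_, ?_⟩
  · have := S.snf i
    rw [hi, zero_smul] at this
    exact S.bN.ne_zero i (Subtype.ext this)
  · ext i j
    change ((LinearMap.toMatrix' l).mulVec (S.bM (S.f j))) i = _
    rw [LinearMap.toMatrix'_mulVec]
    simp [l, LinearMap.funLeft_apply, Finsupp.single_apply, Matrix.one_apply, eq_comm]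
  · ext i j
    change ((LinearMap.toMatrix' v).mulVec (w j)) i = _
    rw [LinearMap.toMatrix'_mulVec]
    have : M.mulVecLin.rangeRestrict (w j) = S.bN j := Subtype.ext (hw j)
    simp [v, this, Matrix.one_apply, eq_comm]
  · refine Matrix.mulVec_injective (funext fun x => ?_)
    rw [← Matrix.mulVec_mulVec, ← Matrix.mulVec_mulVec, LinearMap.toMatrix'_mulVec]
    have := congrArg Subtype.val (S.bN.sum_equivFun (M.mulVecLin.rangeRestrict x))
    rw [LinearMap.codRestrict_apply, Matrix.mulVecLin_apply] at this
    rw [← this]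
    funext r
    simp only [Submodule.coe_sum, Submodule.coe_smul, S.snf, Finset.sum_apply, Pi.smul_apply,
      smul_eq_mul]
    refine Finset.sum_congr rfl fun i _ => ?_
    simp only [Matrix.of_apply, Matrix.mulVec_diagonal, v, LinearMap.comp_apply,
      LinearEquiv.coe_coe]
    ring

variable {n : ℕ}

/-- A Smith form of a polynomial matrix, up to factors prime to `s`: the matrix is
`U * diagonal (s ^ e i * u i) * V` with `U` left invertible and `V` right invertible. -/
structure LocalSmithForm (M : Matrix (Fin p) (Fin q) F[X]) (n : ℕ) where
  U : Matrix (Fin p) (Fin n) F[X]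
  L : Matrix (Fin n) (Fin p) F[X]
  V : Matrix (Fin n) (Fin q) F[X]
  W : Matrix (Fin q) (Fin n) F[X]
  e : Fin n → ℕ
  u : Fin n → F[X]
  L_mul_U : L * U = 1
  V_mul_W : V * W = 1
  eq_mul : M = U * Matrix.diagonal (fun i => X ^ e i * u i) * V
  not_dvd : ∀ i, ¬ X ∣ u i
  monotone : Monotone e

theorem exists_localSmithForm (M : Matrix (Fin p) (Fin q) F[X]) :
    ∃ n, Nonempty (LocalSmithForm M n) := by
  classical
  obtain ⟨n, U, L, a, V, W, ha, hLU, hVW, hM⟩ := exists_smith_factorization M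
  have h : ∀ i, ∃ (e : ℕ) (u : F[X]), a i = X ^ e * u ∧ ¬ X ∣ u := fun i => by
    obtain ⟨u, hu1, hu2⟩ := (FiniteMultiplicity.of_prime_left prime_X
      (ha i)).exists_eq_pow_mul_and_not_dvd
    exact ⟨_, u, hu1, hu2⟩
  choose e u hau hu using h
  let σ := Tuple.sort e
  refine ⟨n, ⟨⟨U.submatrix id σ, L.submatrix σ id, V.submatrix σ id, W.submatrix id σ,
    e ∘ σ, u ∘ σ, ?_, ?_, ?_, fun i => hu _, Tuple.monotone_sort e⟩⟩⟩
  · rw [← Matrix.submatrix_mul _ _ _ id _ Function.bijective_id, hLU, Matrix.submatrix_one_equiv]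
  · rw [← Matrix.submatrix_mul _ _ _ id _ Function.bijective_id, hVW, Matrix.submatrix_one_equiv]
  · have : Matrix.diagonal (fun i => X ^ (e ∘ σ) i * (u ∘ σ) i) =
        (Matrix.diagonal a).submatrix σ σ := by
      rw [Matrix.submatrix_diagonal_equiv]
      congr 1
      funext i
      simp [hau]
    rw [this, Matrix.submatrix_mul_equiv, Matrix.submatrix_mul_equiv, Matrix.submatrix_id_id, hM]

namespace LocalSmithForm

variable {M : Matrix (Fin p) (Fin q) F[X]}

theorem u_ne_zero (S : LocalSmithForm M n) (i : Fin n) : S.u i ≠ 0 := by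
  intro h
  exact S.not_dvd i (h ▸ dvd_zero _)

theorem mul_mul_eq (S : LocalSmithForm M n) :
    S.L * M * S.W = Matrix.diagonal (fun i => X ^ S.e i * S.u i) := by
  refine (congrArg (fun N => S.L * N * S.W) S.eq_mul).trans ?_
  rw [Matrix.mul_assoc, Matrix.mul_assoc S.U, Matrix.mul_assoc S.U, Matrix.mul_assoc _ S.V,
    S.V_mul_W, Matrix.mul_one, ← Matrix.mul_assoc, S.L_mul_U, Matrix.one_mul]

theorem rank_eq (S : LocalSmithForm M n) : (M.map (algebraMap F[X] (RatFunc F))).rank = n := by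
  classical
  have hD : (Matrix.diagonal fun i => algebraMap F[X] (RatFunc F) (X ^ S.e i * S.u i)).rank
      = n := by
    rw [Matrix.rank_diagonal]
    have : ∀ i, algebraMap F[X] (RatFunc F) (X ^ S.e i * S.u i) ≠ 0 := fun i => by
      rw [map_ne_zero_iff _ (IsFractionRing.injective F[X] (RatFunc F))]
      exact mul_ne_zero (pow_ne_zero _ X_ne_zero) (S.u_ne_zero i)
    rw [Fintype.card_congr (Equiv.subtypeUnivEquiv this), Fintype.card_fin]
  apply le_antisymm
  · conv_lhs => rw [S.eq_mul, Matrix.mul_assoc, Matrix.map_mul]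
    exact (Matrix.rank_mul_le_left _ _).trans
      ((Matrix.rank_le_card_width _).trans_eq (Fintype.card_fin n))
  · have h := congrArg (fun N => N.map (algebraMap F[X] (RatFunc F))) S.mul_mul_eq
    simp only [Matrix.map_mul] at h
    rw [Matrix.diagonal_map (map_zero _)] at h
    rw [← hD]
    rw [← h]
    exact (Matrix.rank_mul_le_left _ _).trans (Matrix.rank_mul_le_right _ _)

end LocalSmithForm

theorem dvd_mulVec {R : Type*} [CommRing R] {m k : Type*} [Fintype k] (N : Matrix m k R) {d : R}
    {v : k → R} (h : ∀ j, d ∣ v j) (i : m) : d ∣ N.mulVec v i :=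
  Finset.dvd_sum fun j _ => (h j).mul_left _

theorem X_pow_dvd_X_pow_mul_iff {u f : F[X]} (hu : ¬ X ∣ u) (l e : ℕ) :
    X ^ l ∣ X ^ e * u * f ↔ X ^ (l - e) ∣ f := by
  have hcop : IsCoprime (X ^ l : F[X]) u :=
    ((irreducible_X.coprime_iff_not_dvd).2 hu).pow_left
  have h1 : X ^ l ∣ X ^ e * u * f ↔ X ^ l ∣ X ^ e * f := by
    rw [show X ^ e * u * f = u * (X ^ e * f) by ring]
    exact ⟨hcop.dvd_of_dvd_mul_left, fun h => h.mul_left _⟩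
  rw [h1]
  rcases le_total l e with h | h
  · rw [Nat.sub_eq_zero_of_le h, pow_zero]
    exact ⟨fun _ => one_dvd _, fun _ => (pow_dvd_pow X h).mul_right _⟩
  · conv_lhs => rw [← Nat.add_sub_cancel' h, pow_add]
    exact mul_dvd_mul_iff_left (pow_ne_zero _ X_ne_zero)

namespace LocalSmithForm

variable {M : Matrix (Fin p) (Fin q) F[X]}

/-- Multiplication by `U` and by its left inverse `L` preserves divisibility, so the condition
splits into one for each coordinate of `V x`. -/
theorem X_pow_dvd_mulVec_iff (S : LocalSmithForm M n) (l : ℕ) (x : Fin q → F[X]) :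
    (∀ r, X ^ l ∣ M.mulVec x r) ↔ ∀ i, X ^ (l - S.e i) ∣ S.V.mulVec x i := by
  rw [← forall_congr' fun i => X_pow_dvd_X_pow_mul_iff (S.not_dvd i) l (S.e i)]
  have h1 : ∀ i, X ^ S.e i * S.u i * S.V.mulVec x i =
      ((Matrix.diagonal fun i => X ^ S.e i * S.u i).mulVec (S.V.mulVec x)) i := fun i => by
    rw [Matrix.mulVec_diagonal]
  have h2 : M.mulVec x =
      S.U.mulVec ((Matrix.diagonal fun i => X ^ S.e i * S.u i).mulVec (S.V.mulVec x)) := by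
    rw [Matrix.mulVec_mulVec, Matrix.mulVec_mulVec, ← S.eq_mul]
  have h3 : S.L.mulVec (M.mulVec x) =
      (Matrix.diagonal fun i => X ^ S.e i * S.u i).mulVec (S.V.mulVec x) := by
    rw [h2, Matrix.mulVec_mulVec, S.L_mul_U, Matrix.one_mulVec]
  simp only [h1]
  constructor
  · intro h i
    rw [← h3]
    exact dvd_mulVec _ h i
  · intro h r
    rw [h2]
    exact dvd_mulVec _ h r

end LocalSmithForm

/-- Reduction modulo `s ^ k`. -/
noncomputable def modXPow (F : Type*) [Field F] (k : ℕ) : F[X] →ₗ[F] degreeLT F k :=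
  (modByMonicHom (X ^ k)).codRestrict (degreeLT F k) fun f => by
    rw [mem_degreeLT]
    simpa using degree_modByMonic_lt f (monic_X_pow (R := F) k)

theorem modXPow_eq_zero_iff {k : ℕ} {f : F[X]} : modXPow F k f = 0 ↔ X ^ k ∣ f := by
  rw [← modByMonic_eq_zero_iff_dvd (monic_X_pow k), ← Subtype.coe_inj]
  rfl

theorem modXPow_coe {k : ℕ} (f : degreeLT F k) : modXPow F k (f : F[X]) = f := by
  refine Subtype.ext ((modByMonic_eq_self_iff (monic_X_pow k)).2 ?_)
  simpa using mem_degreeLT.1 f.2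

theorem X_pow_dvd_coe_modXPow_sub (k : ℕ) (f : F[X]) : X ^ k ∣ (modXPow F k f : F[X]) - f := by
  rw [← modXPow_eq_zero_iff, map_sub, modXPow_coe, sub_self]

/-- The dimension of the space of null vectors modulo `s ^ l`. -/
theorem LocalSmithForm.finrank_truncNullVec_add {A : MatrixPencil F p q}
    (S : LocalSmithForm A.toPoly n) (l : ℕ) :
    Module.finrank F (A.truncNullVec l) + ∑ i, (l - S.e i) = q * l := by
  let Ψ : polyVec F q l →ₗ[F] (∀ i, degreeLT F (l - S.e i)) :=
    LinearMap.pi fun i => (modXPow F (l - S.e i)).comp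
      ((LinearMap.proj i).comp ((S.V.mulVecLin.restrictScalars F).comp (polyVec F q l).subtype))
  have hΨ : ∀ x i, Ψ x i = modXPow F (l - S.e i) (S.V.mulVec x i) := fun x i => rfl
  have hsurj : LinearMap.range Ψ = ⊤ := by
    rw [LinearMap.range_eq_top]
    intro y
    let z : Fin n → F[X] := fun i => y i
    -- `W z` is a preimage up to degree; truncating it modulo `s ^ l` is invisible modulo `s ^ (l -
    -- e i)`.
    refine ⟨⟨fun j => modXPow F l (S.W.mulVec z j), mem_polyVec.2 fun j => Subtype.property _⟩, ?_⟩
    funext i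
    rw [hΨ, ← modXPow_coe (y i), ← sub_eq_zero, ← map_sub, modXPow_eq_zero_iff]
    refine (pow_dvd_pow X (Nat.sub_le l (S.e i))).trans ?_
    have h1 : (y i : F[X]) = S.V.mulVec (S.W.mulVec z) i := by
      rw [Matrix.mulVec_mulVec, S.V_mul_W, Matrix.one_mulVec]
    rw [h1, ← Pi.sub_apply, ← Matrix.mulVec_sub]
    exact dvd_mulVec _ (fun j => X_pow_dvd_coe_modXPow_sub _ _) i
  have hker : LinearMap.ker Ψ = (A.truncNullVec l).comap (polyVec F q l).subtype := by
    ext x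
    rw [LinearMap.mem_ker, Submodule.mem_comap, mem_truncNullVec, funext_iff]
    simp only [hΨ, Pi.zero_apply, modXPow_eq_zero_iff]
    rw [← S.X_pow_dvd_mulVec_iff]
    simp only [X_pow_dvd_iff, Submodule.subtype_apply, Submodule.coe_mem, true_and, funext_iff, coeffVec_apply]
    exact ⟨fun h m hm r => h r m hm, fun h r m hm => h m hm r⟩
  have := LinearMap.finrank_range_add_finrank_ker Ψ
  rw [hsurj, finrank_top, hker, finrank_polyVec, Module.finrank_pi_fintype,
    (Submodule.comapSubtypeEquivOfLe (show A.truncNullVec l ≤ polyVec F q l from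
      fun _ h => h.1)).finrank_eq] at this
  simp only [finrank_degreeLT] at this
  rw [← this, add_comm]

end Smith

/-! ### Divisibility of minors -/

section Minors

/-- Each row of the product is a combination of rows of `N`, so multilinearity expands its minor
into minors of `N`, repeated rows being harmless. -/
theorem dvd_det_submatrix_mul_left {R l m o : Type*} [CommRing R] [Fintype m] {k : ℕ}
    (M : Matrix l m R) {N : Matrix m o R} {d : R}
    (h : ∀ (f : Fin k → m) (g : Fin k → o), d ∣ (N.submatrix f g).det)
    (f : Fin k → l) (g : Fin k → o) : d ∣ ((M * N).submatrix f g).det := by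
  classical
  have e : (M * N).submatrix f g = fun i => ∑ x, M (f i) x • fun j => N x (g j) := by
    ext i j
    simp [Matrix.mul_apply, Finset.sum_apply]
  rw [e]
  change d ∣ Matrix.detRowAlternating.toMultilinearMap
    (fun i => ∑ x, M (f i) x • fun j => N x (g j))
  rw [MultilinearMap.map_sum]
  refine Finset.dvd_sum fun r _ => ?_
  rw [MultilinearMap.map_smul_univ, smul_eq_mul]
  exact (h r g).mul_left _

theorem dvd_det_submatrix_mul_right {R l m o : Type*} [CommRing R] [Fintype m] {k : ℕ}
    {M : Matrix l m R} (N : Matrix m o R) {d : R}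
    (h : ∀ (f : Fin k → l) (g : Fin k → m), d ∣ (M.submatrix f g).det)
    (f : Fin k → l) (g : Fin k → o) : d ∣ ((M * N).submatrix f g).det := by
  rw [← Matrix.det_transpose, Matrix.transpose_submatrix, Matrix.transpose_mul]
  refine dvd_det_submatrix_mul_left _ (fun g f => ?_) g f
  rw [← Matrix.transpose_submatrix, Matrix.det_transpose]
  exact h f g

/-- Sorted increasingly, `k` distinct indices dominate `0, …, k - 1` term by term. -/
theorem sum_castLE_le_of_monotone {n k : ℕ} (hk : k ≤ n) {e : Fin n → ℕ} (he : Monotone e)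
    {g : Fin k → Fin n} (hg : Function.Injective g) :
    ∑ i, e (Fin.castLE hk i) ≤ ∑ i, e (g i) := by
  have hs : StrictMono (g ∘ Tuple.sort g) :=
    (Tuple.monotone_sort g).strictMono_of_injective (hg.comp (Tuple.sort g).injective)
  have hle : ∀ m (hm : m < k), m ≤ (g (Tuple.sort g ⟨m, hm⟩) : ℕ) := by
    intro m
    induction m with
    | zero => exact fun _ => Nat.zero_le _
    | succ m ih =>
      intro hm
      have h1 := ih (by omega)
      have h2 : (g ∘ Tuple.sort g) ⟨m, by omega⟩ < (g ∘ Tuple.sort g) ⟨m + 1, hm⟩ :=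
        hs (Fin.mk_lt_mk.2 (Nat.lt_succ_self m))
      rw [Fin.lt_def] at h2
      simp only [Function.comp_apply] at h2
      omega
  rw [← Equiv.sum_comp (Tuple.sort g) fun i => e (g i)]
  exact Finset.sum_le_sum fun i _ => he (Fin.le_def.2 (hle i i.2))

variable {n : ℕ}

theorem X_pow_dvd_det_diagonal {e : Fin n → ℕ} (he : Monotone e) (u : Fin n → F[X]) {k : ℕ}
    (hk : k ≤ n) (f g : Fin k → Fin n) :
    X ^ (∑ i, e (Fin.castLE hk i)) ∣
      ((Matrix.diagonal fun i => X ^ e i * u i).submatrix f g).det := by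
  classical
  by_cases hg : Function.Injective g
  · rw [Matrix.det_apply]
    refine Finset.dvd_sum fun σ _ => ?_
    rw [Units.smul_def, zsmul_eq_mul]
    refine Dvd.dvd.mul_left ?_ _
    by_cases hσ : ∀ i, f (σ i) = g i
    · simp only [Matrix.submatrix_apply, hσ, Matrix.diagonal_apply_eq]
      rw [Finset.prod_mul_distrib, Finset.prod_pow_eq_pow_sum]
      exact (pow_dvd_pow X (sum_castLE_le_of_monotone hk he hg)).mul_right _
    · push Not at hσ
      obtain ⟨i, hi⟩ := hσ
      rw [Finset.prod_eq_zero (Finset.mem_univ i)]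
      · exact dvd_zero _
      · rw [Matrix.submatrix_apply, Matrix.diagonal_apply_ne _ hi]
  · rw [Function.Injective] at hg
    push Not at hg
    obtain ⟨i, j, hij, hne⟩ := hg
    rw [Matrix.det_zero_of_column_eq hne fun r => by simp [hij]]
    exact dvd_zero _

/-- The powers of `s` dividing the minors of a polynomial matrix. -/
theorem LocalSmithForm.X_pow_dvd_minors_iff {M : Matrix (Fin p) (Fin q) F[X]}
    (S : LocalSmithForm M n) {k : ℕ} (hk : k ≤ n) (d : ℕ) :
    (∀ (f : Fin k → Fin p) (g : Fin k → Fin q), X ^ d ∣ (M.submatrix f g).det) ↔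
      d ≤ ∑ i, S.e (Fin.castLE hk i) := by
  constructor
  · intro h
    -- `L * M * W` is the diagonal matrix; its leading minor is the expected power of `s` times a
    -- factor prime to `s`.
    have h1 := dvd_det_submatrix_mul_right S.W (dvd_det_submatrix_mul_left S.L h)
      (Fin.castLE hk) (Fin.castLE hk)
    rw [S.mul_mul_eq, Matrix.submatrix_diagonal _ _ (Fin.castLE_injective hk),
      Matrix.det_diagonal] at h1
    simp only [Function.comp_apply] at h1
    rw [Finset.prod_mul_distrib, Finset.prod_pow_eq_pow_sum] at h1
    have hu : ¬ X ∣ ∏ i, S.u (Fin.castLE hk i) := by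
      rw [prime_X.dvd_finsetProd_iff]
      rintro ⟨i, -, hi⟩
      exact S.not_dvd _ hi
    have h2 := (X_pow_dvd_X_pow_mul_iff hu d (∑ i, S.e (Fin.castLE hk i)) (f := 1)).1
      (by rwa [mul_one])
    by_contra hlt
    exact not_isUnit_X (isUnit_of_dvd_one
      ((dvd_pow_self X (Nat.sub_ne_zero_of_lt (not_le.1 hlt))).trans h2))
  · intro h f g
    refine (pow_dvd_pow X h).trans ?_
    have h1 := dvd_det_submatrix_mul_right S.V (dvd_det_submatrix_mul_left S.U
      (X_pow_dvd_det_diagonal S.monotone S.u hk)) f g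
    rwa [← S.eq_mul] at h1

end Minors

/-! ### Homogeneous minors -/

section Homogeneous

/-- A linear form that generates the linear forms together with `linearForm lam`. -/
noncomputable def complementaryForm (lam : OnePoint F) : MvPolynomial (Fin 2) F :=
  lam.elim (MvPolynomial.X 0) fun _ : F => MvPolynomial.X 1

/-- Restriction of forms to the line parametrized by the local coordinate at `lam`. -/
noncomputable def restrictLine (lam : OnePoint F) : MvPolynomial (Fin 2) F →ₐ[F] F[X] :=
  lam.elim (MvPolynomial.aeval ![1, X]) fun x : F => MvPolynomial.aeval ![X + C x, 1]

theorem restrictLine_linearForm (lam : OnePoint F) : restrictLine lam (linearForm lam) = X := by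
  induction lam using OnePoint.rec <;> simp [restrictLine, linearForm, algebraMap_eq]

theorem restrictLine_complementaryForm (lam : OnePoint F) :
    restrictLine lam (complementaryForm lam) = 1 := by
  induction lam using OnePoint.rec <;> simp [restrictLine, complementaryForm]

theorem homogenization_apply (A : MatrixPencil F p q) (lam : OnePoint F) (r : Fin p) (c : Fin q) :
    A.homogenization r c =
      complementaryForm lam * MvPolynomial.C ((A.localize lam).A₀ r c) +
        linearForm lam * MvPolynomial.C ((A.localize lam).A₁ r c) := by
  induction lam using OnePoint.rec with
  | infty =>
    simp [homogenization, complementaryForm, linearForm, localize, evalAt, shiftAt, add_comm]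
  | coe x =>
    simp [homogenization, complementaryForm, linearForm, localize, evalAt, shiftAt]
    ring

theorem restrictLine_homogenization (A : MatrixPencil F p q) (lam : OnePoint F) :
    A.homogenization.map (restrictLine lam) = (A.localize lam).toPoly := by
  ext1 r c
  rw [Matrix.map_apply, homogenization_apply A lam, map_add, map_mul, map_mul,
    restrictLine_linearForm, restrictLine_complementaryForm, ← MvPolynomial.algebraMap_eq,
    AlgHom.commutes, AlgHom.commutes]
  simp [toPoly, algebraMap_eq]

theorem aeval_homogenize_toPoly (A : MatrixPencil F p q) (lam : OnePoint F) (r : Fin p)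
    (c : Fin q) :
    MvPolynomial.aeval ![linearForm lam, complementaryForm lam]
      (homogenize ((A.localize lam).toPoly r c) 1) = A.homogenization r c := by
  rw [homogenization_apply A lam]
  simp [toPoly, mul_comm (X : F[X]), mul_comm (complementaryForm lam), MvPolynomial.algebraMap_eq,
    mul_comm (linearForm lam)]

theorem homogenize_det {k : ℕ} (N : Matrix (Fin k) (Fin k) F[X])
    (hN : ∀ i j, (N i j).natDegree ≤ 1) :
    homogenize N.det k = (N.map fun f => homogenize f 1).det := by
  rw [Matrix.det_apply, Matrix.det_apply, homogenize_finsetSum]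
  refine Finset.sum_congr rfl fun σ _ => ?_
  rw [Units.smul_def, homogenize_smul, Units.smul_def]
  congr 1
  have := homogenize_finsetProd (s := Finset.univ) (p := fun i => N (σ i) i) (n := fun _ => 1)
    fun i _ => hN _ _
  simpa using this

theorem natDegree_toPoly_le (A : MatrixPencil F p q) (r : Fin p) (c : Fin q) :
    (A.toPoly r c).natDegree ≤ 1 := by
  simp only [toPoly, Matrix.add_apply, Matrix.smul_apply, Matrix.map_apply, smul_eq_mul]
  compute_degree

theorem natDegree_det_submatrix_toPoly_le (A : MatrixPencil F p q) {k : ℕ} (f : Fin k → Fin p)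
    (g : Fin k → Fin q) : (A.toPoly.submatrix f g).det.natDegree ≤ k := by
  rw [Matrix.det_apply]
  refine natDegree_sum_le_of_forall_le _ _ fun σ _ => ?_
  rw [Units.smul_def]
  refine (natDegree_smul_le _ _).trans ((natDegree_prod_le _ _).trans ?_)
  refine (Finset.sum_le_sum fun i _ => A.natDegree_toPoly_le _ _).trans ?_
  simp

theorem X_pow_dvd_homogenize {f : F[X]} {d k : ℕ} (hf : f.natDegree ≤ k) (h : X ^ d ∣ f) :
    (MvPolynomial.X 0 : MvPolynomial (Fin 2) F) ^ d ∣ homogenize f k := by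
  obtain ⟨g, rfl⟩ := h
  by_cases hg : g = 0
  · simp [hg]
  rw [natDegree_mul (pow_ne_zero _ X_ne_zero) hg, natDegree_X_pow] at hf
  obtain ⟨m, rfl⟩ := Nat.exists_eq_add_of_le ((Nat.le_add_right _ _).trans hf)
  rw [homogenize_mul _ _ (natDegree_X_pow d).le (by omega), homogenize_X_pow le_rfl]
  simp

/-- Restriction to the line sends the linear form to `s`. Conversely a minor is a form of degree
`k`, recovered from its restriction by homogenizing and substituting the two linear forms, which
carries `s ^ d` back to `linearForm lam ^ d`. -/
theorem linearForm_pow_dvd_minor_iff (A : MatrixPencil F p q) (lam : OnePoint F) {k : ℕ}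
    (f : Fin k → Fin p) (g : Fin k → Fin q) (d : ℕ) :
    linearForm lam ^ d ∣ (A.homogenization.submatrix f g).det ↔
      X ^ d ∣ ((A.localize lam).toPoly.submatrix f g).det := by
  constructor
  · intro h
    have h1 := map_dvd (restrictLine lam) h
    rwa [map_pow, restrictLine_linearForm, AlgHom.map_det, AlgHom.mapMatrix_apply,
      ← Matrix.submatrix_map, restrictLine_homogenization] at h1
  · intro h
    have h1 := map_dvd (MvPolynomial.aeval ![linearForm lam, complementaryForm lam])
      (X_pow_dvd_homogenize (natDegree_det_submatrix_toPoly_le _ _ _) h)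
    rw [homogenize_det ((A.localize lam).toPoly.submatrix f g) fun i j => (A.localize lam).natDegree_toPoly_le (f i) (g j), AlgHom.map_det,
      map_pow, MvPolynomial.aeval_X] at h1
    have h2 : A.homogenization.submatrix f g =
        (MvPolynomial.aeval ![linearForm lam, complementaryForm lam]).mapMatrix
          (((A.localize lam).toPoly.submatrix f g).map fun f => homogenize f 1) := by
      ext1 i j
      exact (A.aeval_homogenize_toPoly lam _ _).symm
    rwa [h2]

theorem prime_linearForm (lam : OnePoint F) : Prime (linearForm lam) := by
  induction lam using OnePoint.rec with
  | infty => exact MvPolynomial.X_prime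
  | coe x =>
    -- An invertible linear change of variables carries the variable `X 0` to the linear form.
    let Φ : MvPolynomial (Fin 2) F ≃ₐ[F] MvPolynomial (Fin 2) F :=
      AlgEquiv.ofAlgHom
        (MvPolynomial.aeval ![MvPolynomial.X 0 - MvPolynomial.C x * MvPolynomial.X 1,
          MvPolynomial.X 1])
        (MvPolynomial.aeval ![MvPolynomial.X 0 + MvPolynomial.C x * MvPolynomial.X 1,
          MvPolynomial.X 1])
        (by
          ext i : 1
          fin_cases i <;> simp [MvPolynomial.algebraMap_eq])
        (by
          ext i : 1
          fin_cases i <;> simp [MvPolynomial.algebraMap_eq])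
    have h : Φ (MvPolynomial.X 0) = linearForm (x : OnePoint F) := by
      simp [Φ, linearForm]
    rw [← h, MulEquiv.prime_iff]
    exact MvPolynomial.X_prime

/-- The partial multiplicities are the exponents in a local Smith form. -/
theorem IsHomogeneousInvariantFactors.multiplicity_eq {A : MatrixPencil F p q}
    {φ : Fin A.normalRank → MvPolynomial (Fin 2) F} (hφ : A.IsHomogeneousInvariantFactors φ)
    {lam : OnePoint F} (S : LocalSmithForm (A.localize lam).toPoly A.normalRank)
    (j : Fin A.normalRank) : multiplicity (linearForm lam) (φ j) = S.e j := by
  -- The exponent of the form in `φ₁ ⋯ φ_k` is the sum of the `k` smallest `e i`; consecutive values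
  -- of `k` then isolate each factor.
  have hdvd : ∀ k (hk : k ≤ A.normalRank) (d : ℕ), linearForm lam ^ d ∣
      (∏ j ∈ Finset.univ.filter (fun j : Fin A.normalRank => (j : ℕ) < k), φ j) ↔
        d ≤ ∑ i, S.e (Fin.castLE hk i) := by
    intro k hk d
    rw [← S.X_pow_dvd_minors_iff hk]
    simp only [← linearForm_pow_dvd_minor_iff]
    exact ⟨fun h f g => h.trans ((hφ k hk).1 f g), fun h => (hφ k hk).2 _ h⟩
  have hmul : ∀ k (hk : k ≤ A.normalRank), emultiplicity (linearForm lam)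
      (∏ j ∈ Finset.univ.filter (fun j : Fin A.normalRank => (j : ℕ) < k), φ j) =
        ((∑ i, S.e (Fin.castLE hk i) : ℕ) : ℕ∞) := fun k hk =>
    emultiplicity_eq_of_dvd_of_not_dvd ((hdvd k hk _).2 le_rfl) fun h =>
      (Nat.lt_irrefl _ ((hdvd k hk _).1 h))
  have hins : Finset.univ.filter (fun i : Fin A.normalRank => (i : ℕ) < j + 1) =
      insert j (Finset.univ.filter (fun i : Fin A.normalRank => (i : ℕ) < j)) := by
    ext i
    simp [Fin.ext_iff]
    omega
  have h1 := hmul (j + 1) j.2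
  rw [hins, Finset.prod_insert (by simp), emultiplicity_mul (prime_linearForm lam),
    hmul j j.2.le, Fin.sum_univ_castSucc, Nat.cast_add, add_comm] at h1
  have h2 : emultiplicity (linearForm lam) (φ j) = (S.e j : ℕ∞) :=
    ENat.add_right_injective_of_ne_top (ENat.natCast_ne_top _) h1
  exact multiplicity_eq_of_emultiplicity_eq_some h2

end Homogeneous

end MatrixPencil

/-! ### Differences of dimensions and the final count -/

/-- Passing from `l` to `l + 1` raises a positive part by one exactly when `a j ≤ l`; the conjugate
counts the remaining indices. -/
theorem sum_tsub_eq_add_card {m : ℕ} (a : Fin m → ℕ) (l : ℕ) :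
    ∑ j, (l + 1 - a j) + conjugateChain a (l + 1) = ∑ j, (l - a j) + m := by
  have h : ∑ j, (l - a j) + m = ∑ j, (l - a j + 1) := by simp [Finset.sum_add_distrib]
  rw [h, conjugateChain, Finset.card_filter, ← Finset.sum_add_distrib]
  refine Finset.sum_congr rfl fun j _ => ?_
  split_ifs <;> omega

theorem mainTheorem3 {F : Type*} [Field F] [IsAlgClosed F] {p q : ℕ}
    (A : MatrixPencil F p q)
    (φ : Fin A.normalRank → MvPolynomial (Fin 2) F)
    (hφ : A.IsHomogeneousInvariantFactors φ)
    (c : Fin (q - A.normalRank) → ℕ)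
    (hc : A.IsColumnMinimalIndices c)
    (lam : OnePoint F) (i : ℕ) (hi : 1 ≤ i) :
    A.weyr lam i =
      conjugateChain (MatrixPencil.partialMultiplicities φ lam) i +
        (if i = 1 then q - A.normalRank else conjugateChain c (i - 1)) := by
  obtain ⟨n, ⟨S⟩⟩ := MatrixPencil.exists_localSmithForm (A.localize lam).toPoly
  obtain rfl : A.normalRank = n := (A.normalRank_localize lam).symm.trans S.rank_eq
  have hpm : MatrixPencil.partialMultiplicities φ lam = S.e ∘ Fin.revPerm :=
    funext fun j => hφ.multiplicity_eq S j.rev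
  have hconj : conjugateChain (MatrixPencil.partialMultiplicities φ lam) i =
      conjugateChain S.e i := by
    rw [hpm, conjugateChain, conjugateChain, Finset.card_filter, Finset.card_filter]
    exact Equiv.sum_comp Fin.revPerm fun j => if i ≤ S.e j then 1 else 0
  obtain ⟨l, rfl⟩ := Nat.exists_eq_add_of_le' hi
  have hdim : ∀ m, Module.finrank F (A.chainSpace lam m) + ∑ j, (m - 1 - c j) +
      ∑ j, (m - S.e j) = q * m := fun m => by
    rw [← hc.finrank_nullVec, A.finrank_chainSpace_add, S.finrank_truncNullVec_add]
  have h1 : Module.finrank F (A.chainSpace lam (l + 1)) + ∑ j, (l - c j) +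
      ∑ j, (l + 1 - S.e j) = q * l + q := hdim (l + 1)
  have h0 := hdim l
  have hw : A.weyr lam (l + 1) + Module.finrank F (A.chainSpace lam l) =
      Module.finrank F (A.chainSpace lam (l + 1)) := A.weyr_add_finrank lam (l + 1)
  have he := sum_tsub_eq_add_card S.e l
  have hq := A.normalRank_le
  rw [hconj]
  -- For `i = 1` the null vector sums vanish at both levels, as `m - 1 = 0` for `m = 0` and `m = 1`;
  -- this leaves the whole term `q - ρ`.
  rcases l with _ | l
  · simp only [Nat.zero_sub, Finset.sum_const_zero, if_true] at *
    omega
  · have hcc := sum_tsub_eq_add_card c l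
    rw [if_neg (by omega)]
    simp only [Nat.add_sub_cancel] at h0 ⊢
    omega
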